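/- Let $k$ be a field and let $\mathcal T$ be a $k$-linear triangulated category with suspension functor $\Sigma$. Assume that $\mathcal T$ is Hom-finite (every $\operatorname{Hom}_{\mathcal T}(X,Y)$ is a finite-dimensional $k$-vector space) and Krull--Schmidt (every object is a finite direct sum of objects with local endomorphism rings). Let $T$ be an object of $\mathcal T$, let $\Gamma=\operatorname{End}_{\mathcal T}(T)^{\mathrm{op}}$, and let $\operatorname{mod}\Gamma$ be the category of finitely generated left $\Gamma$-modules. Let $\operatorname{add}T$ be the full subcategory of $\mathcal T$ consisting of the direct summands of finite direct sums of copies of $T$. A morphism $f:A\to B$ is called right minimal if every endomorphism $g$ of $A$ with $f\circ g=f$ is an automorphism, and an object $X$ is called $T$-supported if $\operatorname{Hom}_{\mathcal T}(T,X)\neq 0$. Then the functor $\operatorname{Hom}_{\mathcal T}(T,-):\mathcal T\to\operatorname{mod}\Gamma$ is full and dense (i.e. essentially surjective) if and only if the following two conditions are both satisfied. (a) For every right minimal morphism $f:T_1\to T_0$ with $T_0,T_1\in\operatorname{add}T$, every distinguished triangle $T_1\xrightarrow{f}T_0\to X\xrightarrow{h}\Sigma T_1$ satisfies $\operatorname{Hom}_{\mathcal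 T}(T,h)=0$. (b) For every indecomposable $T$-supported object $X$ there exists a distinguished triangle $T_1\to T_0\to X\xrightarrow{h}\Sigma T_1$ with $T_0,T_1\in\operatorname{add}T$ and $\operatorname{Hom}_{\mathcal T}(T,h)=0$. -/

import Mathlib

open CategoryTheory CategoryTheory.Limits CategoryTheory.Pretriangulated

universe w v u

namespace AbelianQuotient

/-- A `k`-linear category is Hom-finite if all its Hom-spaces are finite-dimensional over `k`. -/
class HomFinite (k : Type w) [Field k] (C : Type u) [Category.{v} C] [Preadditive C]
    [Linear k C] : Prop where
  finite_hom (X Y : C) : Module.Finite k (X ⟶ Y)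

/-- An additive category is Krull-Schmidt if every object is a finite direct sum of objects with
local endomorphism rings. -/
class KrullSchmidt (C : Type u) [Category.{v} C] [Preadditive C] [HasFiniteBiproducts C] :
    Prop where
  exists_decomposition (X : C) : ∃ (n : ℕ) (Y : Fin n → C),
    (∀ i, IsLocalRing (End (Y i))) ∧ Nonempty (X ≅ ⨁ Y)

section

variable {C : Type u} [Category.{v} C]

/-- A morphism `f : X ⟶ Y` is right minimal if every endomorphism `g` of `X` whose composite with
`f` equals `f` is an automorphism. -/
def RightMinimal {X Y : C} (f : X ⟶ Y) : Prop :=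
  ∀ g : X ⟶ X, g ≫ f = f → IsIso g

variable [Preadditive C]

/-- `add T`: the direct summands of finite direct sums of copies of `T`. -/
def addClosure [HasBinaryBiproducts C] [HasFiniteBiproducts C] (T : C) : ObjectProperty C := fun X =>
  ∃ (Y : C) (n : ℕ), Nonempty (X ⊞ Y ≅ ⨁ fun _ : Fin n => T)

/-- An object `X` is `T`-supported if `Hom(T, X) ≠ 0`. -/
def Supported (T X : C) : Prop := ∃ f : T ⟶ X, f ≠ 0

/-- In a Hom-finite category, `Hom(T, X)` is finitely generated over `Γ = (End T)ᵐᵒᵖ`. -/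
theorem finite_hom_end (k : Type w) [Field k] [Linear k C] [HomFinite k C] (T X : C) :
    Module.Finite (End T)ᵐᵒᵖ (T ⟶ X) := by
  have : Module.Finite k (T ⟶ X) := HomFinite.finite_hom T X
  have : IsScalarTower k (End T)ᵐᵒᵖ (T ⟶ X) :=
    ⟨fun r g f => Linear.smul_comp _ _ _ r g.unop f⟩
  exact Module.Finite.of_restrictScalars_finite k (End T)ᵐᵒᵖ (T ⟶ X)

/-- The functor `Hom(T, -) : C ⥤ mod Γ`, where `Γ = (End T)ᵐᵒᵖ` (the multiplication of `End T`
being composition of maps) acts on `Hom(T, X)` by precomposition, and `mod Γ` is the category of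
finitely generated left `Γ`-modules. -/
def homFunctor (k : Type w) [Field k] [Linear k C] [HomFinite k C] (T : C) :
    C ⥤ FGModuleCat.{v} (End T)ᵐᵒᵖ :=
  (ModuleCat.isFG.{v} (End T)ᵐᵒᵖ).lift (preadditiveCoyonedaObj T)
    (fun X => finite_hom_end k T X)

end

end AbelianQuotient

/-!
Write `H = Hom(T, -)` and `Γ = (End T)ᵐᵒᵖ`. On `add T` the functor `H` is fully faithful, and even
`Hom(A, X) = Hom_Γ(H A, H X)` for `A` in `add T` and arbitrary `X`
(`hom_ext_of_addClosure`, `exists_hom_of_addClosure`). As the category is Hom-finite, every finitely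
generated `Γ`-module `M` has a presentation `H T₁ ⟶ H T₀ ⟶ M ⟶ 0` by a morphism `f` in `add T`, and
the Krull-Schmidt property allows `f` to be chosen right minimal
(`exists_rightMinimal_presents`). If the triangle `T₁ ⟶ T₀ ⟶ X ⟶ T₁⟦1⟧` over `f` has `H h = 0`, then
`H X` is the cokernel of `H f`, that is, `M` (`presents_of_distTriang`).

Given (a) and (b), density is thus immediate. For fullness it suffices to lift linear maps
`φ : H X ⟶ H Y` with `X` indecomposable and `H X ≠ 0`. With a triangle as in (b), the composite
`H T₀ ⟶ H X ⟶ H Y` comes from a morphism `T₀ ⟶ Y` that vanishes on `T₁`, so it factors through `X`,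
and the factor induces `φ` (`isFull_of_exists_distTriang`).

Conversely let `H` be full and dense. The main point is that an endomorphism of the cone of a right
minimal `f` which fixes `g : T₀ ⟶ X` is invertible (`isIso_of_comp_eq_of_rightMinimal`). For (a),
realize the cokernel of `H f` as `H Y`; the maps `H T₀ ⟶ H Y ⟶ H X` come from `T₀ ⟶ Y ⟶ X`, and
`T₀ ⟶ Y` factors through `X`, which gives such an endomorphism factoring through `Y`, whence `H g` is
surjective (`comp_eq_zero_of_isFull`). For (b), the cone of a right minimal presentation of `H X` is,
by fullness and the same invertibility, a nonzero direct summand of `X`, hence isomorphic to `X`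
(`exists_iso_cone_of_isFull`).

A right minimal version of a morphism out of a sum of objects with local endomorphism rings is found
by discarding superfluous summands (`exists_rightMinimal`), which rests on the fact that
non-isomorphisms between such objects generate a proper ideal, the radical. In this way splitting of
idempotents is never needed.
-/

namespace AbelianQuotient

/-! ### The radical of an additive category -/

section Radical

variable {C : Type u} [Category.{v} C] [Preadditive C]

/-- A morphism `a : X ⟶ Y` is radical if `𝟙 X - a ≫ b` is invertible for every `b : Y ⟶ X`. -/
def IsRadical {X Y : C} (a : X ⟶ Y) : Prop :=
  ∀ b : Y ⟶ X, IsIso (𝟙 X - a ≫ b)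

lemma isIso_id_sub_comp_comm {X Y : C} (x : X ⟶ Y) (y : Y ⟶ X) (h : IsIso (𝟙 Y - y ≫ x)) :
    IsIso (𝟙 X - x ≫ y) := by
  obtain ⟨c, hc₁, hc₂⟩ := h.out
  simp only [Preadditive.sub_comp, Preadditive.comp_sub, Category.assoc, Category.id_comp,
    Category.comp_id] at hc₁ hc₂
  have h₁ : y ≫ x ≫ c = c - 𝟙 Y := by rw [← hc₁]; abel
  have h₂ : c ≫ y ≫ x = c - 𝟙 Y := by rw [← hc₂]; abel
  refine ⟨𝟙 X + x ≫ c ≫ y, ?_, ?_⟩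
  · have h₃ : x ≫ y ≫ x ≫ c ≫ y = x ≫ c ≫ y - x ≫ y := by
      rw [reassoc_of% h₁]; simp
    simp only [Preadditive.sub_comp, Preadditive.comp_add, Category.assoc, Category.id_comp,
      Category.comp_id, h₃]
    abel
  · have h₃ : x ≫ c ≫ y ≫ x ≫ y = x ≫ c ≫ y - x ≫ y := by
      rw [reassoc_of% h₂]; simp
    simp only [Preadditive.comp_sub, Preadditive.add_comp, Category.assoc, Category.id_comp,
      Category.comp_id, h₃]
    abel

lemma IsRadical.comp {X Y Z : C} {a : X ⟶ Y} (ha : IsRadical a) (c : Y ⟶ Z) :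
    IsRadical (a ≫ c) := fun b => by
  simpa using ha (c ≫ b)

lemma IsRadical.precomp {W X Y : C} {a : X ⟶ Y} (ha : IsRadical a) (c : W ⟶ X) :
    IsRadical (c ≫ a) := fun b => by
  rw [Category.assoc]
  exact isIso_id_sub_comp_comm c (a ≫ b) (by simpa using ha (b ≫ c))

lemma IsRadical.zero (X Y : C) : IsRadical (0 : X ⟶ Y) := fun b => by
  rw [zero_comp, sub_zero]; infer_instance

lemma IsRadical.add {X Y : C} {a a' : X ⟶ Y} (ha : IsRadical a) (ha' : IsRadical a') :
    IsRadical (a + a') := fun b => by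
  have h := ha b
  have h' := ha' (b ≫ inv (𝟙 X - a ≫ b))
  have : 𝟙 X - (a + a') ≫ b = (𝟙 X - a' ≫ b ≫ inv (𝟙 X - a ≫ b)) ≫ (𝟙 X - a ≫ b) := by
    rw [Preadditive.sub_comp, Category.assoc, Category.assoc, IsIso.inv_hom_id]
    simp only [Preadditive.add_comp, Category.id_comp, Category.comp_id]
    abel
  rw [this]
  infer_instance

lemma IsRadical.sum {X Y : C} {ι : Type*} (s : Finset ι) {a : ι → (X ⟶ Y)}
    (ha : ∀ i ∈ s, IsRadical (a i)) : IsRadical (∑ i ∈ s, a i) :=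
  Finset.sum_induction a IsRadical (fun _ _ => IsRadical.add) (IsRadical.zero X Y) ha

/-- Between objects with local endomorphism rings, every non-isomorphism is radical: otherwise it
would be a split monomorphism onto a nonzero direct summand of an indecomposable object. -/
lemma isRadical_of_not_isIso {X Y : C} [IsLocalRing (End X)] [IsLocalRing (End Y)] {a : X ⟶ Y}
    (ha : ¬ IsIso a) : IsRadical a := by
  intro b
  rcases IsLocalRing.isUnit_or_isUnit_of_add_one (add_sub_cancel (End.of (a ≫ b)) 1) with h | h
  swap
  · exact (isUnit_iff_isIso _).1 h
  exfalso
  have hu : IsIso (a ≫ b) := (isUnit_iff_isIso _).1 h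
  obtain ⟨c, hc₁, -⟩ := hu.out
  have hc : a ≫ b ≫ c = 𝟙 X := by simpa using hc₁
  rcases IsLocalRing.isUnit_or_isUnit_of_add_one
      (add_sub_cancel (End.of (b ≫ c ≫ a)) 1) with h | h
  · have : IsIso (b ≫ c ≫ a) := (isUnit_iff_isIso _).1 h
    refine ha ⟨b ≫ c, hc, ?_⟩
    rw [← cancel_epi (b ≫ c ≫ a)]
    simp [reassoc_of% hc]
  · have : IsIso (𝟙 Y - b ≫ c ≫ a) := (isUnit_iff_isIso _).1 h
    have ha0 : a = 0 := by
      rw [← cancel_mono (𝟙 Y - b ≫ c ≫ a)]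
      simp [Preadditive.comp_sub, reassoc_of% hc]
    rw [ha0, zero_comp] at hc
    exact one_ne_zero (α := End X) hc.symm

end Radical

/-! ### Objects with local endomorphism rings and right minimal morphisms -/

section RightMinimal

variable {C : Type u} [Category.{v} C] [Preadditive C]

lemma indecomposable_of_isLocalRing_end [HasBinaryBiproducts C] (X : C) [IsLocalRing (End X)] :
    Indecomposable X := by
  have hX : (𝟙 X : X ⟶ X) ≠ 0 := one_ne_zero (α := End X)
  refine ⟨fun h => hX ((IsZero.iff_id_eq_zero X).1 h), fun Y Z e => ?_⟩
  let a : X ⟶ X := e.hom ≫ biprod.fst ≫ biprod.inl ≫ e.inv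
  have ha : 𝟙 X - a = e.hom ≫ biprod.snd ≫ biprod.inr ≫ e.inv := by
    rw [sub_eq_iff_eq_add]
    have := congrArg (fun z => e.hom ≫ z ≫ e.inv) (biprod.total (X := Y) (Y := Z))
    simp only [Preadditive.add_comp, Preadditive.comp_add, Category.assoc, Category.id_comp,
      e.hom_inv_id] at this
    rw [← this, add_comm]
  rcases IsLocalRing.isUnit_or_isUnit_of_add_one (add_sub_cancel (End.of a) 1) with h | h
  · right
    have : IsIso a := (isUnit_iff_isIso _).1 h
    rw [IsZero.iff_id_eq_zero]
    have h0 : biprod.inr ≫ e.inv = (0 : Z ⟶ X) := by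
      rw [← cancel_mono a]; simp [a]
    calc 𝟙 Z = (biprod.inr ≫ e.inv) ≫ e.hom ≫ biprod.snd := by simp
      _ = 0 := by rw [h0, zero_comp]
  · left
    have : IsIso (𝟙 X - a) := (isUnit_iff_isIso _).1 h
    rw [IsZero.iff_id_eq_zero]
    have h0 : biprod.inl ≫ e.inv = (0 : Y ⟶ X) := by
      rw [← cancel_mono (𝟙 X - a), ha]; simp
    calc 𝟙 Y = (biprod.inl ≫ e.inv) ≫ e.hom ≫ biprod.fst := by simp
      _ = 0 := by rw [h0, zero_comp]

variable [HasFiniteBiproducts C]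

/-- An endomorphism `g` of a finite direct sum of objects with local endomorphism rings is
invertible as soon as no matrix entry of `𝟙 - g` is. -/
lemma exists_isIso_entry {n : ℕ} (Y : Fin n → C) (hY : ∀ i, IsLocalRing (End (Y i)))
    {g : ⨁ Y ⟶ ⨁ Y} (hg : ¬ IsIso g) :
    ∃ i j, IsIso (biproduct.ι Y i ≫ (𝟙 _ - g) ≫ biproduct.π Y j) := by
  by_contra! h
  have key : IsRadical (𝟙 _ - g) := by
    have : 𝟙 _ - g = ∑ i, ∑ j, (biproduct.π Y i ≫
        (biproduct.ι Y i ≫ (𝟙 _ - g) ≫ biproduct.π Y j)) ≫ biproduct.ι Y j := by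
      calc 𝟙 _ - g = (∑ i, biproduct.π Y i ≫ biproduct.ι Y i) ≫ (𝟙 _ - g) ≫
            (∑ j, biproduct.π Y j ≫ biproduct.ι Y j) := by
            rw [biproduct.total, Category.id_comp, Category.comp_id]
        _ = _ := by
            simp only [Preadditive.sum_comp, Preadditive.comp_sum, Category.assoc]
            exact Finset.sum_comm
    rw [this]
    exact IsRadical.sum _ fun i _ => IsRadical.sum _ fun j _ =>
      ((isRadical_of_not_isIso (h i j)).precomp _).comp _
  exact hg (by simpa using key (𝟙 _))

/-- Every morphism `f` out of a finite direct sum of objects with local endomorphism rings has a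
right minimal version: a right minimal restriction to a direct summand through which `f` factors.
If `f` is not right minimal, some `s` with `s ≫ f = 0` has an invertible component, so that the
corresponding summand can be discarded. -/
lemma exists_rightMinimal {n : ℕ} (Y : Fin n → C) (hY : ∀ i, IsLocalRing (End (Y i))) {B : C}
    (f : ⨁ Y ⟶ B) :
    ∃ (A : C) (i : A ⟶ ⨁ Y) (p r : ⨁ Y ⟶ A),
      i ≫ p = 𝟙 A ∧ RightMinimal (i ≫ f) ∧ r ≫ i ≫ f = f := by
  induction n with
  | zero =>
    refine ⟨⨁ Y, 𝟙 _, 𝟙 _, 𝟙 _, by simp, fun g _ => ?_, by simp⟩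
    by_contra hg
    obtain ⟨i, -⟩ := exists_isIso_entry Y hY hg
    exact i.elim0
  | succ m ih =>
    by_cases hf : RightMinimal f
    · exact ⟨⨁ Y, 𝟙 _, 𝟙 _, 𝟙 _, by simp, by simpa using hf, by simp⟩
    obtain ⟨g, hgf, hg⟩ : ∃ g : ⨁ Y ⟶ ⨁ Y, g ≫ f = f ∧ ¬ IsIso g := by
      simpa [RightMinimal] using hf
    obtain ⟨j, i, hu⟩ := exists_isIso_entry Y hY hg
    obtain ⟨s, hs⟩ : ∃ s, s = biproduct.ι Y j ≫ (𝟙 _ - g) := ⟨_, rfl⟩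
    have hsf : s ≫ f = 0 := by simp [hs, hgf, Preadditive.sub_comp]
    rw [← Category.assoc, ← hs] at hu
    obtain ⟨c, -, hc⟩ := hu.out
    let Y' : Fin m → C := fun l => Y (i.succAbove l)
    let inc : ⨁ Y' ⟶ ⨁ Y := biproduct.desc fun l => biproduct.ι Y (i.succAbove l)
    let proj : ⨁ Y ⟶ ⨁ Y' := biproduct.lift fun l => biproduct.π Y (i.succAbove l)
    have hip : inc ≫ proj = 𝟙 _ := by
      ext l l'
      simp only [inc, proj, biproduct.ι_desc_assoc, Category.assoc, biproduct.lift_π,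
        Category.id_comp]
      by_cases hl : l = l'
      · subst hl
        simp [Y']
      · rw [biproduct.ι_π_ne Y' (Ne.symm hl),
          biproduct.ι_π_ne Y fun h => hl (Fin.succAbove_right_injective h).symm]
    have hpi : proj ≫ inc = 𝟙 _ - biproduct.π Y i ≫ biproduct.ι Y i := by
      rw [← biproduct.total, Fin.sum_univ_succAbove _ i, add_sub_cancel_left,
        biproduct.lift_desc]
    obtain ⟨A, i', p', r', h₁, h₂, h₃⟩ := ih Y' (fun l => hY _) (inc ≫ f)
    -- Modulo `s ≫ f = 0`, the `i`-th component of `f` is expressed through the other ones by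
    -- subtracting `c ≫ s`, whose `i`-th component is the identity.
    refine ⟨A, i' ≫ inc, proj ≫ p', (𝟙 _ - biproduct.π Y i ≫ c ≫ s) ≫ proj ≫ r', ?_, ?_, ?_⟩
    · simp [reassoc_of% hip, h₁]
    · simpa using h₂
    · have h₄ : c ≫ s ≫ biproduct.π Y i ≫ biproduct.ι Y i ≫ f = biproduct.ι Y i ≫ f := by
        rw [reassoc_of% hc]
      simp only [Category.assoc, h₃, reassoc_of% hpi]
      simp [Preadditive.sub_comp, Preadditive.comp_sub, hsf, h₄]

lemma exists_rightMinimal_of_krullSchmidt [KrullSchmidt C] {A B : C} (f : A ⟶ B) :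
    ∃ (A' : C) (i : A' ⟶ A) (p r : A ⟶ A'),
      i ≫ p = 𝟙 A' ∧ RightMinimal (i ≫ f) ∧ r ≫ i ≫ f = f := by
  obtain ⟨n, Y, hY, ⟨e⟩⟩ := KrullSchmidt.exists_decomposition A
  obtain ⟨A', i, p, r, h₁, h₂, h₃⟩ := exists_rightMinimal Y hY (e.inv ≫ f)
  refine ⟨A', i ≫ e.inv, e.hom ≫ p, e.hom ≫ r, by simp [h₁], by simpa using h₂, ?_⟩
  simp [h₃]

end RightMinimal

/-! ### Morphisms out of objects of `add T` -/

section AddClosure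

variable {C : Type u} [Category.{v} C] [Preadditive C]

/-- Postcomposition with `f`, as a map of `(End T)ᵐᵒᵖ`-modules. -/
def postcomp (T : C) {X Y : C} (f : X ⟶ Y) : (T ⟶ X) →ₗ[(End T)ᵐᵒᵖ] (T ⟶ Y) where
  toFun t := t ≫ f
  map_add' _ _ := Preadditive.add_comp _ _ _ _ _ _
  map_smul' _ _ := Category.assoc _ _ _

@[simp]
lemma postcomp_apply (T : C) {X Y : C} (f : X ⟶ Y) (t : T ⟶ X) : postcomp T f t = t ≫ f := rfl

/-- A linear map between modules `Hom(T, -)` commutes with precomposition by endomorphisms of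
`T`. -/
lemma map_comp_of_linear {T X Y : C} (φ : (T ⟶ X) →ₗ[(End T)ᵐᵒᵖ] (T ⟶ Y)) (a : T ⟶ T)
    (t : T ⟶ X) : φ (a ≫ t) = a ≫ φ t :=
  φ.map_smul (MulOpposite.op (End.of a)) t

variable [HasBinaryBiproducts C] [HasFiniteBiproducts C] {T : C}

/-- The identity of an object of `add T` is a finite sum of endomorphisms factoring through
`T`. -/
lemma exists_sum_eq_id_of_addClosure {A : C} (hA : addClosure T A) :
    ∃ (n : ℕ) (a : Fin n → (A ⟶ T)) (b : Fin n → (T ⟶ A)), ∑ i, a i ≫ b i = 𝟙 A := by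
  obtain ⟨Y, n, ⟨e⟩⟩ := hA
  refine ⟨n, fun i => biprod.inl ≫ e.hom ≫ biproduct.π _ i,
    fun i => biproduct.ι (fun _ : Fin n => T) i ≫ e.inv ≫ biprod.fst, ?_⟩
  calc _ = biprod.inl ≫ e.hom ≫ (∑ i, biproduct.π (fun _ : Fin n => T) i ≫
        biproduct.ι (fun _ : Fin n => T) i) ≫
        e.inv ≫ biprod.fst := by
        simp only [Preadditive.sum_comp, Preadditive.comp_sum, Category.assoc]
    _ = _ := by rw [biproduct.total]; simp

lemma hom_ext_of_addClosure {A X : C} (hA : addClosure T A) {w w' : A ⟶ X}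
    (h : ∀ t : T ⟶ A, t ≫ w = t ≫ w') : w = w' := by
  obtain ⟨n, a, b, hab⟩ := exists_sum_eq_id_of_addClosure hA
  rw [← Category.id_comp w, ← Category.id_comp w', ← hab]
  simp only [Preadditive.sum_comp, Category.assoc, h]

lemma exists_hom_of_addClosure {A X : C} (hA : addClosure T A)
    (φ : (T ⟶ A) →ₗ[(End T)ᵐᵒᵖ] (T ⟶ X)) : ∃ w : A ⟶ X, ∀ t, φ t = t ≫ w := by
  obtain ⟨n, a, b, hab⟩ := exists_sum_eq_id_of_addClosure hA
  refine ⟨∑ i, a i ≫ φ (b i), fun t => ?_⟩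
  calc φ t = φ (t ≫ ∑ i, a i ≫ b i) := by rw [hab, Category.comp_id]
    _ = ∑ i, φ ((t ≫ a i) ≫ b i) := by
        simp only [Preadditive.comp_sum, map_sum, Category.assoc]
    _ = _ := by
        rw [Preadditive.comp_sum]
        exact Finset.sum_congr rfl fun i _ => by rw [map_comp_of_linear, Category.assoc]

end AddClosure

/-! ### Presentations of modules -/

section Presentation

variable {C : Type u} [Category.{v} C] [Preadditive C]

/-- A `Γ`-module `M` is presented by `f : T₁ ⟶ T₀` through `φ` if
`Hom(T, T₁) ⟶ Hom(T, T₀) ⟶ M ⟶ 0` is exact, where the map to `M` is `φ`. -/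
structure Presents {T T₁ T₀ : C} {M : Type*} [AddCommGroup M] [Module (End T)ᵐᵒᵖ M]
    (f : T₁ ⟶ T₀) (φ : (T ⟶ T₀) →ₗ[(End T)ᵐᵒᵖ] M) : Prop where
  surjective : Function.Surjective φ
  map_eq_zero_iff : ∀ t, φ t = 0 ↔ ∃ s : T ⟶ T₁, s ≫ f = t

section

variable {T T₁ T₀ : C} {M N : Type*} [AddCommGroup M] [Module (End T)ᵐᵒᵖ M] [AddCommGroup N]
  [Module (End T)ᵐᵒᵖ N] {f : T₁ ⟶ T₀} {φ : (T ⟶ T₀) →ₗ[(End T)ᵐᵒᵖ] M}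

lemma Presents.exists_lift (hφ : Presents f φ) (ψ : (T ⟶ T₀) →ₗ[(End T)ᵐᵒᵖ] N)
    (hψ : ∀ s : T ⟶ T₁, ψ (s ≫ f) = 0) : ∃ l : M →ₗ[(End T)ᵐᵒᵖ] N, ∀ t, l (φ t) = ψ t := by
  have hker : LinearMap.ker φ ≤ LinearMap.ker ψ := by
    intro t ht
    obtain ⟨s, rfl⟩ := (hφ.map_eq_zero_iff t).1 ht
    exact hψ s
  let e := φ.quotKerEquivOfSurjective hφ.surjective
  refine ⟨(LinearMap.ker φ).liftQ ψ hker ∘ₗ e.symm.toLinearMap, fun t => ?_⟩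
  have he : e.symm (φ t) = Submodule.Quotient.mk t := by
    rw [LinearEquiv.symm_apply_eq]; rfl
  rw [LinearMap.comp_apply, LinearEquiv.coe_coe, he, Submodule.liftQ_apply]

lemma Presents.exists_linearEquiv {ψ : (T ⟶ T₀) →ₗ[(End T)ᵐᵒᵖ] N} (hφ : Presents f φ)
    (hψ : Presents f ψ) : Nonempty (M ≃ₗ[(End T)ᵐᵒᵖ] N) := by
  obtain ⟨l, hl⟩ := hφ.exists_lift ψ fun s => (hψ.map_eq_zero_iff _).2 ⟨s, rfl⟩
  obtain ⟨l', hl'⟩ := hψ.exists_lift φ fun s => (hφ.map_eq_zero_iff _).2 ⟨s, rfl⟩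
  refine ⟨LinearEquiv.ofLinearMap l l' (LinearMap.ext fun y => ?_) (LinearMap.ext fun x => ?_)⟩
  · obtain ⟨t, rfl⟩ := hψ.surjective y
    simp [hl, hl']
  · obtain ⟨t, rfl⟩ := hφ.surjective x
    simp [hl, hl']

end

/-- Every finitely generated module has a presentation by a morphism between finite direct sums of
copies of `T`, since `Hom(T, X)` is a Noetherian module for every `X`. -/
lemma exists_presents [HasFiniteBiproducts C] (k : Type w) [Field k] [Linear k C] [HomFinite k C]
    (T : C) (M : Type*) [AddCommGroup M] [Module (End T)ᵐᵒᵖ M] [Module.Finite (End T)ᵐᵒᵖ M] :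
    ∃ (m n : ℕ) (f : (⨁ fun _ : Fin m => T) ⟶ ⨁ fun _ : Fin n => T)
      (φ : (T ⟶ ⨁ fun _ : Fin n => T) →ₗ[(End T)ᵐᵒᵖ] M), Presents f φ := by
  obtain ⟨n, x, hx⟩ := Module.Finite.exists_fin (R := (End T)ᵐᵒᵖ) (M := M)
  -- `Hom(T, T^n) ⟶ M` takes the inclusion of the `i`-th summand to the `i`-th generator.
  let φ : (T ⟶ ⨁ fun _ : Fin n => T) →ₗ[(End T)ᵐᵒᵖ] M :=
    { toFun := fun t =>
        ∑ i, MulOpposite.op (End.of (t ≫ biproduct.π (fun _ : Fin n => T) i)) • x i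
      map_add' := fun s t => by
        rw [← Finset.sum_add_distrib]
        refine Finset.sum_congr rfl fun i _ => ?_
        rw [← add_smul, ← MulOpposite.op_add, Preadditive.add_comp]
      map_smul' := fun r t => by
        rw [RingHom.id_apply, Finset.smul_sum]
        refine Finset.sum_congr rfl fun i _ => ?_
        rw [← mul_smul]
        congr 1
        exact MulOpposite.unop_injective (Category.assoc _ _ _) }
  have hφ : Function.Surjective φ := by
    rw [← LinearMap.range_eq_top, eq_top_iff, ← hx, Submodule.span_le]
    rintro _ ⟨i, rfl⟩
    refine ⟨biproduct.ι (fun _ : Fin n => T) i, ?_⟩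
    change ∑ j, MulOpposite.op (End.of (biproduct.ι (fun _ : Fin n => T) i ≫
      biproduct.π (fun _ : Fin n => T) j)) • x j = x i
    rw [Finset.sum_eq_single i]
    · rw [biproduct.ι_π_self]
      exact one_smul _ _
    · intro j _ hj
      rw [biproduct.ι_π_ne _ hj.symm]
      exact zero_smul _ _
    · simp
  have hN : IsNoetherian (End T)ᵐᵒᵖ (T ⟶ ⨁ fun _ : Fin n => T) := by
    have : Module.Finite k (T ⟶ ⨁ fun _ : Fin n => T) := HomFinite.finite_hom _ _
    have : IsScalarTower k (End T)ᵐᵒᵖ (T ⟶ ⨁ fun _ : Fin n => T) :=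
      ⟨fun r g f => Linear.smul_comp _ _ _ r g.unop f⟩
    exact isNoetherian_of_tower k inferInstance
  obtain ⟨m, y, hy⟩ := Submodule.fg_iff_exists_fin_generating_family.1
    (hN.noetherian (LinearMap.ker φ))
  refine ⟨m, n, biproduct.desc y, φ, hφ, fun t => ?_⟩
  rw [← LinearMap.mem_ker, ← hy, Submodule.mem_span_range_iff_exists_fun]
  constructor
  · rintro ⟨c, rfl⟩
    refine ⟨biproduct.lift fun i => (c i).unop, ?_⟩
    rw [biproduct.lift_desc]
    rfl
  · rintro ⟨s, rfl⟩
    refine ⟨fun i => MulOpposite.op (End.of (s ≫ biproduct.π _ i)), ?_⟩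
    calc _ = ∑ i, (s ≫ biproduct.π (fun _ : Fin m => T) i) ≫ y i := rfl
      _ = s ≫ (∑ i, biproduct.π (fun _ : Fin m => T) i ≫ biproduct.ι (fun _ : Fin m => T) i) ≫
          biproduct.desc y := by
          simp only [Preadditive.sum_comp, Preadditive.comp_sum, Category.assoc,
            biproduct.ι_desc]
      _ = _ := by rw [biproduct.total, Category.id_comp]

end Presentation

/-! ### Direct summands and cones -/

section Pretriangulated

variable {C : Type u} [Category.{v} C] [Preadditive C] [HasZeroObject C] [HasShift C ℤ]
  [∀ n : ℤ, (shiftFunctor C n).Additive] [Pretriangulated C]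

/-- In a pretriangulated category, a retract is a direct summand; a complement is provided by a
cone. -/
lemma exists_biprod_iso_of_retract {A B : C} (s : A ⟶ B) (p : B ⟶ A) (h : s ≫ p = 𝟙 A) :
    ∃ Z : C, Nonempty (A ⊞ Z ≅ B) := by
  obtain ⟨Z, q, d, hT⟩ := distinguished_cocone_triangle s
  have : Mono s := mono_of_mono_fac h
  have hd : d = 0 := (Triangle.mor₃_eq_zero_iff_mono₁ _ hT).2 this
  obtain ⟨e, -⟩ := exists_iso_binaryBiproduct_of_distTriang _ hT hd
  exact ⟨Z, ⟨e.symm⟩⟩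

lemma addClosure_of_retract {T A B : C} (hB : addClosure T B) (s : A ⟶ B) (p : B ⟶ A)
    (h : s ≫ p = 𝟙 A) : addClosure T A := by
  obtain ⟨Y, n, ⟨e⟩⟩ := hB
  obtain ⟨Z, ⟨e'⟩⟩ := exists_biprod_iso_of_retract (s ≫ biprod.inl ≫ e.hom)
    (e.inv ≫ biprod.fst ≫ p) (by simp [h])
  exact ⟨Z, n, ⟨e'⟩⟩

lemma addClosure_biproduct (T : C) (n : ℕ) : addClosure T (⨁ fun _ : Fin n => T) := by
  obtain ⟨Z, e⟩ := exists_biprod_iso_of_retract (𝟙 (⨁ fun _ : Fin n => T)) (𝟙 _) (by simp)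
  exact ⟨Z, n, e⟩

/-- If `Hom(T, h) = 0` in a triangle `T₁ ⟶ T₀ ⟶ X ⟶ T₁⟦1⟧`, then `Hom(T, X)` is the cokernel of
`Hom(T, T₁) ⟶ Hom(T, T₀)`. -/
lemma presents_of_distTriang {T T₁ T₀ X : C} {f : T₁ ⟶ T₀} {g : T₀ ⟶ X} {h : X ⟶ T₁⟦(1 : ℤ)⟧}
    (hT : Triangle.mk f g h ∈ distTriang C) (hh : ∀ t : T ⟶ X, t ≫ h = 0) :
    Presents f (postcomp T g) where
  surjective t := by
    obtain ⟨s, hs⟩ := Triangle.coyoneda_exact₃ _ hT t (hh t)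
    exact ⟨s, hs.symm⟩
  map_eq_zero_iff t := by
    refine ⟨fun ht => ?_, ?_⟩
    · obtain ⟨s, hs⟩ := Triangle.coyoneda_exact₂ _ hT t ht
      exact ⟨s, hs.symm⟩
    · rintro ⟨s, rfl⟩
      have hfg : f ≫ g = 0 := comp_distTriang_mor_zero₁₂ _ hT
      simp [hfg]

/-- If `f` is right minimal, an endomorphism of its cone that fixes `g` is invertible: it extends
to an endomorphism of the triangle which is the identity on `T₀` and hence invertible on `T₁`. -/
lemma isIso_of_comp_eq_of_rightMinimal {T₁ T₀ X : C} {f : T₁ ⟶ T₀} {g : T₀ ⟶ X}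
    {h : X ⟶ T₁⟦(1 : ℤ)⟧} (hT : Triangle.mk f g h ∈ distTriang C) (hf : RightMinimal f)
    {e : X ⟶ X} (he : g ≫ e = g) : IsIso e := by
  obtain ⟨a, ha, ha'⟩ := complete_distinguished_triangle_morphism₁ _ _ hT hT (𝟙 T₀) e
    (show g ≫ e = 𝟙 T₀ ≫ g by simpa using he)
  change f ≫ 𝟙 T₀ = a ≫ f at ha
  have hia : IsIso a := hf a (ha.symm.trans (Category.comp_id f))
  let m : Triangle.mk f g h ⟶ Triangle.mk f g h :=
    { hom₁ := a, hom₂ := 𝟙 T₀, hom₃ := e, comm₁ := ha, comm₂ := show g ≫ e = 𝟙 T₀ ≫ g by simpa using he, comm₃ := ha' }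
  exact isIso₃_of_isIso₁₂ m hT hT hia (inferInstanceAs (IsIso (𝟙 T₀)))

/-- Every finitely generated module has a presentation by a right minimal morphism in `add T`. -/
lemma exists_rightMinimal_presents (k : Type w) [Field k] [Linear k C] [HomFinite k C]
    [KrullSchmidt C] (T : C) (M : Type*) [AddCommGroup M] [Module (End T)ᵐᵒᵖ M]
    [Module.Finite (End T)ᵐᵒᵖ M] :
    ∃ (T₁ T₀ : C) (f : T₁ ⟶ T₀) (φ : (T ⟶ T₀) →ₗ[(End T)ᵐᵒᵖ] M),
      addClosure T T₁ ∧ addClosure T T₀ ∧ RightMinimal f ∧ Presents f φ := by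
  obtain ⟨m, n, f, φ, hφ⟩ := exists_presents k T M
  obtain ⟨A, i, p, r, hip, hmin, hr⟩ := exists_rightMinimal_of_krullSchmidt f
  refine ⟨A, _, i ≫ f, φ, addClosure_of_retract (addClosure_biproduct T m) i p hip,
    addClosure_biproduct T n, hmin, hφ.surjective, fun t => (hφ.map_eq_zero_iff t).trans ⟨?_, ?_⟩⟩
  · rintro ⟨s, rfl⟩
    exact ⟨s ≫ r, by simp [hr]⟩
  · rintro ⟨s, rfl⟩
    exact ⟨s ≫ i, by simp⟩

end Pretriangulated

/-! ### Fullness and density in terms of linear maps -/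

section HomFunctor

variable {C : Type u} [Category.{v} C] [Preadditive C] {k : Type w} [Field k] [Linear k C]
  [HomFinite k C] {T : C}

lemma homFunctor_map_eq_zero_iff {X Y : C} (h : X ⟶ Y) :
    (homFunctor k T).map h = 0 ↔ ∀ t : T ⟶ X, t ≫ h = 0 := by
  constructor
  · intro h0 t
    exact congrArg (fun a => a.hom.hom t) h0
  · intro h0
    apply FGModuleCat.hom_ext
    ext t
    exact h0 t

lemma homFunctor_full_iff :
    (homFunctor k T).Full ↔ ∀ (X Y : C) (φ : (T ⟶ X) →ₗ[(End T)ᵐᵒᵖ] (T ⟶ Y)),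
      ∃ w : X ⟶ Y, ∀ t, φ t = t ≫ w := by
  constructor
  · intro hF X Y φ
    obtain ⟨w, hw⟩ := hF.map_surjective (X := X) (Y := Y)
      (ObjectProperty.homMk (ModuleCat.ofHom φ))
    exact ⟨w, fun t => (congrArg (fun a => a.hom.hom t) hw).symm⟩
  · intro h
    refine ⟨fun {X Y} a => ?_⟩
    obtain ⟨w, hw⟩ := h X Y a.hom.hom
    refine ⟨w, ?_⟩
    apply FGModuleCat.hom_ext
    ext t
    exact (hw t).symm

lemma homFunctor_essSurj_iff :
    (homFunctor k T).EssSurj ↔ ∀ (M : Type v) [AddCommGroup M] [Module (End T)ᵐᵒᵖ M]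
      [Module.Finite (End T)ᵐᵒᵖ M], ∃ X : C, Nonempty ((T ⟶ X) ≃ₗ[(End T)ᵐᵒᵖ] M) := by
  constructor
  · intro hE M _ _ _
    obtain ⟨X, ⟨e⟩⟩ := hE.mem_essImage (FGModuleCat.of (End T)ᵐᵒᵖ M)
    exact ⟨X, ⟨FGModuleCat.isoToLinearEquiv e⟩⟩
  · intro h
    refine ⟨fun M => ?_⟩
    obtain ⟨X, ⟨e⟩⟩ := h M
    exact ⟨X, ⟨ObjectProperty.isoMk _ (LinearEquiv.toModuleIso e)⟩⟩

end HomFunctor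

/-! ### Full and dense functors Hom(T, -) and triangles in add T -/

section Main

variable {C : Type u} [Category.{v} C] [Preadditive C] [HasZeroObject C] [HasShift C ℤ]
  [∀ n : ℤ, (shiftFunctor C n).Additive] [Pretriangulated C] {T : C}

/-- `Hom(T, -)` is full, expressed without reference to the category of modules. -/
def IsFull (T : C) : Prop :=
  ∀ (X Y : C) (φ : (T ⟶ X) →ₗ[(End T)ᵐᵒᵖ] (T ⟶ Y)), ∃ w : X ⟶ Y, ∀ t, φ t = t ≫ w

/-- If `Hom(T, -)` is full and the cokernel of `Hom(T, f)` is of the form `Hom(T, Y)`, where `f`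
is a right minimal morphism in `add T`, then `Hom(T, h) = 0` for every triangle over `f`. One finds
`v : Y ⟶ X` and `u : X ⟶ Y` for which `u ≫ v` fixes `g`; hence `u ≫ v` is invertible, and
`Hom(T, g)` is surjective. -/
lemma comp_eq_zero_of_isFull (hfull : IsFull T) {T₁ T₀ X Y : C} {f : T₁ ⟶ T₀} {g : T₀ ⟶ X}
    {h : X ⟶ T₁⟦(1 : ℤ)⟧} (h₁ : addClosure T T₁) (h₀ : addClosure T T₀) (hf : RightMinimal f)
    (hT : Triangle.mk f g h ∈ distTriang C) {π : (T ⟶ T₀) →ₗ[(End T)ᵐᵒᵖ] (T ⟶ Y)}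
    (hπ : Presents f π) (t : T ⟶ X) : t ≫ h = 0 := by
  have hfg : f ≫ g = 0 := comp_distTriang_mor_zero₁₂ _ hT
  have hgh : g ≫ h = 0 := comp_distTriang_mor_zero₂₃ _ hT
  obtain ⟨g', hg'⟩ := exists_hom_of_addClosure h₀ π
  have hfg' : f ≫ g' = 0 := hom_ext_of_addClosure h₁ fun s => by
    rw [← Category.assoc, ← hg', (hπ.map_eq_zero_iff _).2 ⟨s, rfl⟩, comp_zero]
  obtain ⟨u, hu⟩ : ∃ u : X ⟶ Y, g' = g ≫ u := Triangle.yoneda_exact₂ _ hT g' hfg'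
  obtain ⟨l, hl⟩ := hπ.exists_lift (postcomp T g) fun s => by simp [hfg]
  obtain ⟨v, hv⟩ := hfull _ _ l
  have hg'v : g' ≫ v = g := hom_ext_of_addClosure h₀ fun s => by
    rw [← Category.assoc, ← hg', ← hv, hl, postcomp_apply]
  have huv : IsIso (u ≫ v) := isIso_of_comp_eq_of_rightMinimal hT hf (by
    rw [← Category.assoc, ← hu, hg'v])
  obtain ⟨r, hr⟩ := hπ.surjective (t ≫ inv (u ≫ v) ≫ u)
  have ht : t = r ≫ g := by
    rw [← hg'v, ← Category.assoc, ← hg', hr]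
    simp
  rw [ht, Category.assoc, hgh, comp_zero]

/-- If `Hom(T, -)` is full and `X` is indecomposable, then `X` is isomorphic to the cone of any
right minimal morphism in `add T` presenting `Hom(T, X) ≠ 0`: the cone is a direct summand of `X`,
because every endomorphism of it inducing the identity on `Hom(T, -)` is invertible. -/
lemma exists_iso_cone_of_isFull (hfull : IsFull T) {T₁ T₀ X X' : C} {f : T₁ ⟶ T₀} {g : T₀ ⟶ X'}
    {h : X' ⟶ T₁⟦(1 : ℤ)⟧} (h₀ : addClosure T T₀) (hf : RightMinimal f)
    (hT : Triangle.mk f g h ∈ distTriang C) (hX : Indecomposable X) (hTX : Supported T X)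
    (e : (T ⟶ X') ≃ₗ[(End T)ᵐᵒᵖ] (T ⟶ X)) : Nonempty (X' ≅ X) := by
  obtain ⟨a, ha⟩ := hfull _ _ e.toLinearMap
  obtain ⟨b, hb⟩ := hfull _ _ e.symm.toLinearMap
  have hab : IsIso (a ≫ b) := isIso_of_comp_eq_of_rightMinimal hT hf <|
    hom_ext_of_addClosure h₀ fun t => by
      simp only [← Category.assoc]
      rw [← ha, ← hb]
      simp
  obtain ⟨Z, ⟨i⟩⟩ := exists_biprod_iso_of_retract a (b ≫ inv (a ≫ b)) (by simp [← Category.assoc])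
  rcases hX.2 _ _ i.symm with h0 | h0
  · obtain ⟨t, ht⟩ := hTX
    exact (ht (by rw [← e.apply_symm_apply t, h0.eq_zero_of_tgt (e.symm t), map_zero])).elim
  · exact ⟨isoBiprodZero h0 ≪≫ i⟩

/-- To lift linear maps `Hom(T, X) ⟶ Hom(T, Y)` for all `X` and `Y`, it suffices to treat
indecomposable `T`-supported objects `X`, and those are cones on which `Hom(T, -)` is right
exact. -/
lemma isFull_of_exists_distTriang [KrullSchmidt C]
    (hpres : ∀ X : C, Indecomposable X → Supported T X →
      ∃ (T₁ T₀ : C) (f : T₁ ⟶ T₀) (g : T₀ ⟶ X) (h : X ⟶ T₁⟦(1 : ℤ)⟧),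
        addClosure T T₁ ∧ addClosure T T₀ ∧ Triangle.mk f g h ∈ distTriang C ∧
        ∀ t : T ⟶ X, t ≫ h = 0) : IsFull T := by
  have key : ∀ (X Y : C), Indecomposable X → ∀ φ : (T ⟶ X) →ₗ[(End T)ᵐᵒᵖ] (T ⟶ Y),
      ∃ w : X ⟶ Y, ∀ t, φ t = t ≫ w := by
    intro X Y hX φ
    by_cases hTX : Supported T X
    swap
    · have h0 : ∀ t : T ⟶ X, t = 0 := by simpa [Supported] using hTX
      exact ⟨0, fun t => by rw [h0 t, map_zero, zero_comp]⟩
    obtain ⟨T₁, T₀, f, g, h, h₁, h₀, hT, hh⟩ := hpres X hX hTX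
    have hfg : f ≫ g = 0 := comp_distTriang_mor_zero₁₂ _ hT
    obtain ⟨w, hw⟩ := exists_hom_of_addClosure h₀ (φ ∘ₗ postcomp T g)
    have hfw : f ≫ w = 0 := hom_ext_of_addClosure h₁ fun s => by
      rw [← Category.assoc, ← hw]
      simp [hfg]
    obtain ⟨u, hu⟩ : ∃ u : X ⟶ Y, w = g ≫ u := Triangle.yoneda_exact₂ _ hT w hfw
    refine ⟨u, fun t => ?_⟩
    obtain ⟨s, rfl⟩ := (presents_of_distTriang hT hh).surjective t
    rw [postcomp_apply, Category.assoc, ← hu, ← hw, LinearMap.comp_apply, postcomp_apply]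
  intro X Y φ
  obtain ⟨n, Z, hZ, ⟨e⟩⟩ := KrullSchmidt.exists_decomposition X
  choose w hw using fun i => key (Z i) Y (indecomposable_of_isLocalRing_end (Z i))
    (φ ∘ₗ postcomp T (biproduct.ι Z i ≫ e.inv))
  refine ⟨∑ i, e.hom ≫ biproduct.π Z i ≫ w i, fun t => ?_⟩
  have ht : t = ∑ i, (t ≫ e.hom ≫ biproduct.π Z i) ≫ biproduct.ι Z i ≫ e.inv := by
    calc t = t ≫ e.hom ≫ (∑ i, biproduct.π Z i ≫ biproduct.ι Z i) ≫ e.inv := by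
          rw [biproduct.total]; simp
      _ = _ := by simp only [Preadditive.sum_comp, Preadditive.comp_sum, Category.assoc]
  conv_lhs => rw [ht]
  rw [map_sum, Preadditive.comp_sum]
  refine Finset.sum_congr rfl fun i _ => ?_
  calc _ = (φ ∘ₗ postcomp T (biproduct.ι Z i ≫ e.inv)) (t ≫ e.hom ≫ biproduct.π Z i) := rfl
    _ = _ := by rw [hw]; simp only [Category.assoc]

end Main

end AbelianQuotient

open AbelianQuotient

theorem mainTheorem1 (k : Type w) [Field k] (C : Type u) [Category.{v} C] [Preadditive C]
    [Linear k C] [HasZeroObject C] [HasShift C ℤ] [∀ n : ℤ, (shiftFunctor C n).Additive]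
    [Pretriangulated C] [IsTriangulated C]
    [AbelianQuotient.HomFinite k C] [AbelianQuotient.KrullSchmidt C] (T : C) :
    ((AbelianQuotient.homFunctor k T).Full ∧ (AbelianQuotient.homFunctor k T).EssSurj) ↔
      (∀ (T₁ T₀ X : C) (f : T₁ ⟶ T₀) (g : T₀ ⟶ X) (h : X ⟶ T₁⟦(1 : ℤ)⟧),
        AbelianQuotient.addClosure T T₁ → AbelianQuotient.addClosure T T₀ →
        AbelianQuotient.RightMinimal f → Triangle.mk f g h ∈ distTriang C →
          (AbelianQuotient.homFunctor k T).map h = 0) ∧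
      (∀ X : C, Indecomposable X → AbelianQuotient.Supported T X →
        ∃ (T₁ T₀ : C) (f : T₁ ⟶ T₀) (g : T₀ ⟶ X) (h : X ⟶ T₁⟦(1 : ℤ)⟧),
          AbelianQuotient.addClosure T T₁ ∧ AbelianQuotient.addClosure T T₀ ∧
          Triangle.mk f g h ∈ distTriang C ∧
          (AbelianQuotient.homFunctor k T).map h = 0) := by
  simp only [homFunctor_map_eq_zero_iff, homFunctor_full_iff, homFunctor_essSurj_iff]
  constructor
  · rintro ⟨hfull, hdense⟩
    have ha : ∀ (T₁ T₀ X : C) (f : T₁ ⟶ T₀) (g : T₀ ⟶ X) (h : X ⟶ T₁⟦(1 : ℤ)⟧),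
        addClosure T T₁ → addClosure T T₀ → RightMinimal f → Triangle.mk f g h ∈ distTriang C →
          ∀ t : T ⟶ X, t ≫ h = 0 := by
      intro T₁ T₀ X f g h h₁ h₀ hf hT
      have : Module.Finite (End T)ᵐᵒᵖ (T ⟶ T₀) := finite_hom_end k T T₀
      let K := LinearMap.range (postcomp T f)
      obtain ⟨Y, ⟨e⟩⟩ := hdense ((T ⟶ T₀) ⧸ K)
      refine comp_eq_zero_of_isFull hfull h₁ h₀ hf hT
        (π := e.symm.toLinearMap ∘ₗ K.mkQ) ⟨?_, fun t => ?_⟩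
      · exact e.symm.surjective.comp K.mkQ_surjective
      · rw [LinearMap.comp_apply, LinearEquiv.coe_coe, LinearEquiv.map_eq_zero_iff,
          Submodule.mkQ_apply, Submodule.Quotient.mk_eq_zero]
        rfl
    -- `X` is the cone of a minimal presentation of `Hom(T, X)`.
    refine ⟨ha, fun X hX hTX => ?_⟩
    have : Module.Finite (End T)ᵐᵒᵖ (T ⟶ X) := finite_hom_end k T X
    obtain ⟨T₁, T₀, f, φ, h₁, h₀, hf, hφ⟩ := exists_rightMinimal_presents k T (T ⟶ X)
    obtain ⟨X', g, h, hT⟩ := distinguished_cocone_triangle f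
    have hh := ha _ _ _ _ _ _ h₁ h₀ hf hT
    obtain ⟨e⟩ := (presents_of_distTriang hT hh).exists_linearEquiv hφ
    obtain ⟨i⟩ := exists_iso_cone_of_isFull hfull h₀ hf hT hX hTX e
    refine ⟨T₁, T₀, f, g ≫ i.hom, i.inv ≫ h, h₁, h₀, ?_, fun t => ?_⟩
    · exact isomorphic_distinguished _ hT _
        (Triangle.isoMk _ _ (Iso.refl _) (Iso.refl _) i.symm
        (show f ≫ 𝟙 T₀ = 𝟙 T₁ ≫ f by simp)
        (show (g ≫ i.hom) ≫ i.inv = 𝟙 T₀ ≫ g by simp)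
        (show (i.inv ≫ h) ≫ (𝟙 T₁)⟦(1 : ℤ)⟧' = i.inv ≫ h by simp))
    · rw [← Category.assoc, hh]
  · rintro ⟨ha, hb⟩
    refine ⟨isFull_of_exists_distTriang hb, fun M _ _ _ => ?_⟩
    obtain ⟨T₁, T₀, f, φ, h₁, h₀, hf, hφ⟩ := exists_rightMinimal_presents k T M
    obtain ⟨X, g, h, hT⟩ := distinguished_cocone_triangle f
    exact ⟨X, (presents_of_distTriang hT (ha _ _ _ _ _ _ h₁ h₀ hf hT)).exists_linearEquiv hφ⟩
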